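/- Let $M_T, M_R \ge 1$ be integers, let $\sigma \ge 0$, and let $\Phi$ be a random real $M_R \times M_T$ matrix whose entries are i.i.d. $\mathcal N(0,\sigma^2)$. Put $\widetilde\Theta = \mathbf 1 + \mathrm j\,\Phi$, where $\mathbf 1$ is the $M_R\times M_T$ all-ones matrix and $\mathrm j=\sqrt{-1}$, and let $M_d = |M_T - M_R|$. Write $\chi^2_{n,\sigma^2}$ for a random variable distributed as $\|x\|^2$ with $x \sim \mathcal N(0,\sigma^2 I_n)$, and $\beta(a,b)$ for a beta-distributed random variable with density $\frac{\Gamma(a+b)}{\Gamma(a)\Gamma(b)}x^{a-1}(1-x)^{b-1}$ on $(0,1)$, for $a,b>0$; by convention $\beta(a,0)$ is the constant $1$. Then, with $\stackrel{d}{=}$ denoting equality in distribution: If $M_R \le M_T$, $$\det(\widetilde\Theta\widetilde\Theta^H) \stackrel{d}{=} \Big(\chi^2_{M_d+1,\sigma^2} + M_T M_R\,\beta\big(\tfrac{M_d+1}{2},\tfrac{M_R-1}{2}\big)\Big)\prod_{i=1}^{M_R-1}\chi^2_{M_T-i+1,\sigma^2}.$$ If $M_R > M_T$, $$\det(\widetilde\Theta^H\widetilde\Theta)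 \stackrel{d}{=} \Big(\chi^2_{M_d+1,\sigma^2} + M_T M_R\,\beta\big(\tfrac{M_d+1}{2},\tfrac{M_T-1}{2}\big)\Big)\prod_{i=1}^{M_T-1}\chi^2_{M_R-i+1,\sigma^2}.$$ In both cases all the chi-square variables and the beta variable on the right-hand side are mutually independent, and an empty product equals $1$. -/

import Mathlib

open MeasureTheory ProbabilityTheory
open scoped NNReal Matrix

noncomputable section

/-- The matrix `1 + j Φ`, where `1` is the all-ones matrix (not the identity) and `j` the
imaginary unit. -/
def thetaTilde {m n : ℕ} (Φ : Matrix (Fin m) (Fin n) ℝ) : Matrix (Fin m) (Fin n) ℂ :=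
  Matrix.of fun k l => 1 + Complex.I * (Φ k l : ℂ)

/-- The law `χ²_{n,v}`: the law of `‖x‖²` (Euclidean norm) for `x ∼ N(0, v I_n)`. -/
def chiSqLaw (n : ℕ) (v : ℝ≥0) : Measure ℝ :=
  (Measure.pi fun _ : Fin n => gaussianReal 0 v).map fun x => ∑ i, x i ^ 2

/-- The beta law with parameters `a > 0` and `b ≥ 0`, where `b = 0` means the point mass
at `1`, which is the weak limit of the beta laws as `b` decreases to `0`. -/
def betaLaw (a b : ℝ) : Measure ℝ :=
  if b = 0 then Measure.dirac 1 else betaMeasure a b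

/-- The number `|a - b|` for natural numbers. -/
def absDiff (a b : ℕ) : ℕ := ((a : ℤ) - (b : ℤ)).natAbs

instance isProbabilityMeasure_chiSqLaw (n : ℕ) (v : ℝ≥0) :
    IsProbabilityMeasure (chiSqLaw n v) := by
  have h : Measurable fun x : Fin n → ℝ => ∑ i, x i ^ 2 := by fun_prop
  exact Measure.isProbabilityMeasure_map h.aemeasurable

theorem isProbabilityMeasure_betaLaw {a b : ℝ} (ha : 0 < a) (hb : 0 ≤ b) :
    IsProbabilityMeasure (betaLaw a b) := by
  unfold betaLaw
  split_ifs with h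
  · infer_instance
  · exact isProbabilityMeasureBeta ha (lt_of_le_of_ne hb (Ne.symm h))

end

/-! Take `k + 1` rows and `k + d` columns, so that `d` is `M_d + 1`. A real orthogonal map of the
columns carrying the all-ones vector to `√(k + 1)` times the last basis vector preserves the
determinant and the Gaussian law. It leaves rows `j G` and one last row `a + j b`, where `a` is
constant with `‖a‖² = (k + d)(k + 1)`, and `G`, `b` are independent Gaussian
(`exists_orthogonal_det_thetaTilde`).

For fixed `G`, let `P` project onto `d` orthonormal directions orthogonal to the rows of `G`. Base
times squared height gives the determinant `gramDet G * (‖P b‖² + ‖P a‖²)`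
(`exists_orthogonal_shiftedDet_eq`), with no mixed term because `a` and `b` are real. By rotation
invariance `‖P b‖²` is chi-square with `d` degrees of freedom whatever `G` is.

The vector `a` is deterministic, so `‖P a‖²` depends on `G`. But the law of the determinant depends
on `a` only through `‖a‖`, so `a` may be replaced by a vector of that length pointing along an
independent standard Gaussian `h`. Then `‖P a‖²` becomes `‖a‖² ‖P h‖² / ‖h‖²`, a multiple of a beta
variable independent of `G` and `b` (`lintegral_shiftedDet`). Finally, the same height formula with
`a = 0` and induction on the rows give `gramDet G` as a product of independent chi-squares
(`map_gramDet_gaussianPi`). -/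

/-! ### Gamma and beta laws -/

theorem lintegral_comp_mul_left_eq (s : ℝ) (hs : 0 < s) {f : ℝ → ENNReal} (hf : Measurable f) :
    ∫⁻ x, f x = ∫⁻ t, ENNReal.ofReal s * f (s * t) := by
  conv_lhs => rw [← Real.smul_map_volume_mul_left hs.ne']
  rw [lintegral_smul_measure, lintegral_map hf (by fun_prop), lintegral_const_mul _ (by fun_prop),
    abs_of_pos hs, smul_eq_mul]

theorem measurable_gammaPDF (a r : ℝ) : Measurable (gammaPDF a r) :=
  (measurable_gammaPDFReal a r).ennreal_ofReal

theorem measurable_betaPDF (a b : ℝ) : Measurable (betaPDF a b) :=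
  (measurable_betaPDFReal a b).ennreal_ofReal

/-- The factor `s` is the Jacobian of `(s, t) ↦ (s t, s - s t)`. The values `t = 0, 1` are excluded
because the densities' endpoint conventions disagree there; they form a null set. -/
theorem gammaPDF_mul_gammaPDF {p q r : ℝ} (hp : 0 < p) (hq : 0 < q) (hr : 0 < r) {s t : ℝ}
    (hs : 0 < s) (ht0 : t ≠ 0) (ht1 : t ≠ 1) :
    ENNReal.ofReal s * (gammaPDF p r (s * t) * gammaPDF q r (s - s * t)) =
      gammaPDF (p + q) r s * betaPDF p q t := by
  rcases lt_or_gt_of_ne ht0 with h | h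
  · rw [betaPDF_eq_zero_of_nonpos h.le, gammaPDF_of_neg (mul_neg_of_pos_of_neg hs h)]
    simp
  rcases lt_or_gt_of_ne ht1 with h1 | h1
  · have e : s - s * t = s * (1 - t) := by ring
    have h1' : 0 < 1 - t := by linarith
    rw [betaPDF_of_pos_lt_one h h1, gammaPDF_of_nonneg hs.le, gammaPDF_of_nonneg (by positivity),
      e, gammaPDF_of_nonneg (by positivity)]
    have hb := beta_pos hp hq
    have := Real.Gamma_pos_of_pos hp
    have := Real.Gamma_pos_of_pos hq
    have := Real.Gamma_pos_of_pos (add_pos hp hq)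
    rw [← ENNReal.ofReal_mul (by positivity), ← ENNReal.ofReal_mul (by positivity),
      ← ENNReal.ofReal_mul (by positivity)]
    congr 1
    rw [Real.mul_rpow hs.le h.le, Real.mul_rpow hs.le h1'.le, Real.rpow_add hr,
      show -(r * s) = -(r * (s * t)) + -(r * (s * (1 - t))) by ring, Real.exp_add,
      show p + q - 1 = 1 + (p - 1) + (q - 1) by ring, Real.rpow_add hs, Real.rpow_add hs,
      Real.rpow_one, beta]
    field_simp
  · rw [betaPDF_eq_zero_of_one_le h1.le, gammaPDF_of_neg (x := s - s * t) (by nlinarith)]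
    simp

theorem map_gammaMeasure_prod_gammaMeasure {p q r : ℝ} (hp : 0 < p) (hq : 0 < q) (hr : 0 < r) :
    ((gammaMeasure p r).prod (gammaMeasure q r)).map (fun z => (z.1 + z.2, z.1 / (z.1 + z.2))) =
      (gammaMeasure (p + q) r).prod (betaMeasure p q) := by
  have := isProbabilityMeasure_gammaMeasure hp hr
  have := isProbabilityMeasure_gammaMeasure hq hr
  have := isProbabilityMeasure_gammaMeasure (add_pos hp hq) hr
  have := isProbabilityMeasureBeta hp hq
  have mp := measurable_gammaPDF p r
  have mq := measurable_gammaPDF q r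
  have mpq := measurable_gammaPDF (p + q) r
  have mb := measurable_betaPDF p q
  refine Measure.ext_of_lintegral _ fun F hF => ?_
  rw [lintegral_map hF (by fun_prop), lintegral_prod _ (by fun_prop),
    lintegral_prod _ (by fun_prop)]
  unfold gammaMeasure betaMeasure
  rw [lintegral_withDensity_eq_lintegral_mul _ mp (by fun_prop),
    lintegral_withDensity_eq_lintegral_mul _ mpq (by fun_prop)]
  simp only [Pi.mul_apply]
  have h1 : ∀ x, gammaPDF p r x * ∫⁻ y, F (x + y, x / (x + y)) ∂(volume.withDensity (gammaPDF q r))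
      = ∫⁻ s, gammaPDF p r x * gammaPDF q r (s - x) * F (s, x / s) := by
    intro x
    rw [lintegral_withDensity_eq_lintegral_mul _ mq (by fun_prop),
      ← lintegral_const_mul _ (by fun_prop),
      -- Substitute `y = s - x`, so that `s` is the sum; the scaling `x = s t` follows after the
      -- swap of integrals.
      ← lintegral_sub_right_eq_self _ x]
    refine lintegral_congr fun s => ?_
    simp [mul_assoc]
  simp_rw [h1]
  rw [lintegral_lintegral_swap (by fun_prop)]
  have h0 : ∀ᵐ s : ℝ, s ≠ 0 := by simp [ae_iff]
  have h1' : ∀ᵐ s : ℝ, s ≠ 1 := by simp [ae_iff]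
  refine lintegral_congr_ae ?_
  filter_upwards [h0] with s hs
  rcases lt_or_gt_of_ne hs with hs | hs
  · rw [gammaPDF_of_neg hs, zero_mul]
    refine lintegral_eq_zero_of_ae_eq_zero (Filter.Eventually.of_forall fun x => ?_)
    rcases lt_or_ge x 0 with hx | hx
    · simp [gammaPDF_of_neg hx]
    · simp [gammaPDF_of_neg (x := s - x) (by linarith)]
  · rw [lintegral_comp_mul_left_eq s hs (by fun_prop),
      lintegral_withDensity_eq_lintegral_mul _ mb (by fun_prop),
      ← lintegral_const_mul _ (by fun_prop)]
    refine lintegral_congr_ae ?_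
    filter_upwards [h0, h1'] with t ht0 ht1
    simp only [Pi.mul_apply]
    rw [← mul_assoc, gammaPDF_mul_gammaPDF hp hq hr hs ht0 ht1, mul_div_cancel_left₀ _ hs.ne',
      mul_assoc]

theorem map_sq_gaussianReal :
    (gaussianReal 0 1).map (fun x => x ^ 2) = gammaMeasure (1 / 2) (1 / 2) := by
  refine Measure.ext_of_lintegral _ fun f hf => ?_
  have mg := measurable_gammaPDF (1 / 2) (1 / 2)
  have mn := measurable_gaussianPDF 0 1
  rw [lintegral_map hf (by fun_prop), gaussianReal_of_var_ne_zero _ one_ne_zero, gammaMeasure,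
    lintegral_withDensity_eq_lintegral_mul _ mn (by fun_prop),
    lintegral_withDensity_eq_lintegral_mul _ mg (by fun_prop)]
  simp only [Pi.mul_apply]
  rw [← lintegral_add_compl (fun x => gaussianPDF 0 1 x * f (x ^ 2)) measurableSet_Ioi
      (A := Set.Ioi 0),
    ← lintegral_add_compl (fun x => gammaPDF (1 / 2) (1 / 2) x * f x) measurableSet_Ioi
      (A := Set.Ioi 0), Set.compl_Ioi]
  -- Squaring is two-to-one: by symmetry the negative half-line contributes as much as the positive
  -- one, where squaring is injective.
  have e1 : ∫⁻ x in Set.Iic 0, gaussianPDF 0 1 x * f (x ^ 2) =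
      ∫⁻ x in Set.Ioi 0, gaussianPDF 0 1 x * f (x ^ 2) := by
    rw [setLIntegral_congr Iio_ae_eq_Iic.symm]
    have := lintegral_image_eq_lintegral_abs_deriv_mul (s := Set.Ioi (0 : ℝ)) measurableSet_Ioi
      (f := fun x => -x) (f' := fun _ => -1) (fun x _ => (hasDerivAt_neg x).hasDerivWithinAt)
      neg_injective.injOn (fun x => gaussianPDF 0 1 x * f (x ^ 2))
    simpa [gaussianPDF, gaussianPDFReal] using this
  have e2 : ∫⁻ x in Set.Iic 0, gammaPDF (1 / 2) (1 / 2) x * f x = 0 := by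
    rw [setLIntegral_congr Iio_ae_eq_Iic.symm]
    refine setLIntegral_eq_zero measurableSet_Iio fun x hx => ?_
    simp [gammaPDF_of_neg hx]
  have e3 := lintegral_image_eq_lintegral_abs_deriv_mul (s := Set.Ioi (0 : ℝ)) measurableSet_Ioi
      (f := fun x => x ^ 2) (f' := fun x => 2 * x)
      (fun x _ => by simpa using (hasDerivAt_pow 2 x).hasDerivWithinAt)
      (fun x hx y hy h => (pow_left_inj₀ (le_of_lt hx) (le_of_lt hy) two_ne_zero).1 h)
      (fun x => gammaPDF (1 / 2) (1 / 2) x * f x)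
  have e4 : (fun x : ℝ => x ^ 2) '' Set.Ioi 0 = Set.Ioi 0 := by
    ext y
    constructor
    · rintro ⟨x, hx, rfl⟩
      exact pow_pos (Set.mem_Ioi.1 hx) 2
    · intro hy
      exact ⟨√y, Real.sqrt_pos.2 hy, Real.sq_sqrt (le_of_lt hy)⟩
  rw [e4] at e3
  rw [e1, e2, add_zero, e3, ← lintegral_add_left (by fun_prop)]
  refine setLIntegral_congr_fun measurableSet_Ioi fun x hx => ?_
  have hx : 0 < x := hx
  rw [← add_mul, ← mul_assoc]
  congr 1
  rw [gammaPDF_of_nonneg (by positivity), gaussianPDF, ← ENNReal.ofReal_mul (by positivity),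
    ← ENNReal.ofReal_add (gaussianPDFReal_nonneg _ _ _) (gaussianPDFReal_nonneg _ _ _)]
  congr 1
  rw [gaussianPDFReal, Real.Gamma_one_half_eq, abs_of_pos (by positivity),
    show ((1 : ℝ) / 2 - 1) = -(1 / 2) by norm_num, Real.rpow_neg (by positivity),
    ← Real.sqrt_eq_rpow, ← Real.sqrt_eq_rpow, Real.sqrt_sq hx.le, Real.sqrt_mul (by positivity),
    Real.sqrt_mul (by positivity), Real.sqrt_div (by positivity)]
  simp
  field_simp
  ring_nf

/-! ### Orthogonal invariance of Gaussian vectors -/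

/-- The law of a vector of independent centred Gaussian variables with variance `v`. -/
noncomputable def gaussianPi (ι : Type*) [Fintype ι] (v : ℝ≥0) : Measure (ι → ℝ) :=
  Measure.pi fun _ => gaussianReal 0 v

instance (ι : Type*) [Fintype ι] (v : ℝ≥0) : IsProbabilityMeasure (gaussianPi ι v) := by
  unfold gaussianPi; infer_instance

theorem charFun_map_toLp_gaussianPi {ι : Type*} [Fintype ι] (v : ℝ≥0) (t : EuclideanSpace ℝ ι) :
    charFun ((gaussianPi ι v).map (WithLp.toLp 2)) t = Complex.exp (-(v * ‖t‖ ^ 2 / 2)) := by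
  rw [gaussianPi, charFun_pi]
  simp_rw [charFun_gaussianReal]
  rw [← Complex.exp_sum, ← Complex.ofReal_pow, EuclideanSpace.real_norm_sq_eq]
  congr 1
  push_cast
  rw [Finset.mul_sum, Finset.sum_div, ← Finset.sum_neg_distrib]
  refine Finset.sum_congr rfl fun i _ => ?_
  simp

/-- The characteristic function depends only on the norm, so isometries preserve the law. Working
without densities also covers `v = 0`. -/
theorem map_gaussianPi_of_sum_sq_eq {ι : Type*} [Fintype ι] (v : ℝ≥0)
    (L : (ι → ℝ) →ₗ[ℝ] (ι → ℝ)) (hL : ∀ x, ∑ i, L x i ^ 2 = ∑ i, x i ^ 2) :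
    (gaussianPi ι v).map L = gaussianPi ι v := by
  let L' : EuclideanSpace ℝ ι →ₗᵢ[ℝ] EuclideanSpace ℝ ι :=
    { toLinearMap := (WithLp.linearEquiv 2 ℝ (ι → ℝ)).symm.toLinearMap ∘ₗ L ∘ₗ
        (WithLp.linearEquiv 2 ℝ (ι → ℝ)).toLinearMap
      norm_map' := fun x => by
        have : ‖WithLp.toLp 2 (L x.ofLp)‖ ^ 2 = ‖x‖ ^ 2 := by
          rw [EuclideanSpace.real_norm_sq_eq, EuclideanSpace.real_norm_sq_eq]
          exact hL x.ofLp
        exact (pow_left_inj₀ (norm_nonneg _) (norm_nonneg _) two_ne_zero).1 this }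
  let E := L'.toLinearIsometryEquiv rfl
  have mL : Measurable L := L.continuous_of_finiteDimensional.measurable
  have mE : Measurable E := E.continuous.measurable
  have hE : (fun x => E (WithLp.toLp 2 x)) = fun x : ι → ℝ => WithLp.toLp 2 (L x) := rfl
  have key : ((gaussianPi ι v).map (WithLp.toLp 2)).map E =
      (gaussianPi ι v).map (WithLp.toLp 2) := by
    have : IsProbabilityMeasure ((gaussianPi ι v).map (WithLp.toLp 2)) :=
      Measure.isProbabilityMeasure_map (by fun_prop)
    have : IsProbabilityMeasure (((gaussianPi ι v).map (WithLp.toLp 2)).map E) :=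
      Measure.isProbabilityMeasure_map (by fun_prop)
    refine Measure.ext_of_charFun (funext fun t => ?_)
    have h2 : ∀ t, charFun (((gaussianPi ι v).map (WithLp.toLp 2)).map E) t =
        charFun ((gaussianPi ι v).map (WithLp.toLp 2)) (E.symm t) := by
      intro t
      rw [charFun_apply, charFun_apply, integral_map (by fun_prop) (by fun_prop)]
      congr 1 with x
      rw [← E.inner_map_map x, E.apply_symm_apply]
    rw [h2, charFun_map_toLp_gaussianPi, charFun_map_toLp_gaussianPi, E.symm.norm_map]
  rw [Measure.map_map mE (by fun_prop)] at key
  have := congrArg (Measure.map (WithLp.ofLp)) key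
  rw [Measure.map_map (by fun_prop) (by fun_prop),
    Measure.map_map (by fun_prop) (by fun_prop)] at this
  have i1 : (WithLp.ofLp ∘ WithLp.toLp 2 : (ι → ℝ) → (ι → ℝ)) = id := rfl
  rw [i1, Measure.map_id] at this
  exact this

/-! ### Chi-square laws and their ratios -/

theorem chiSqLaw_eq_map_gaussianPi (n : ℕ) (v : ℝ≥0) :
    chiSqLaw n v = (gaussianPi (Fin n) v).map fun x => ∑ i, x i ^ 2 := rfl

theorem measurePreserving_gaussianPi_equiv {ι κ : Type*} [Fintype ι] [Fintype κ] (e : κ ≃ ι)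
    (v : ℝ≥0) : MeasurePreserving (fun (x : ι → ℝ) k => x (e k)) (gaussianPi ι v)
      (gaussianPi κ v) := by
  have := measurePreserving_piCongrLeft (α := fun _ => ℝ) (fun _ : κ => gaussianReal 0 v) e.symm
  convert this using 1
  · ext x k
    simp [MeasurableEquiv.piCongrLeft, Equiv.piCongrLeft_apply]
  all_goals rfl

theorem measurePreserving_gaussianPi_sum {ι κ τ : Type*} [Fintype ι] [Fintype κ] [Fintype τ]
    (e : ι ⊕ κ ≃ τ) (v : ℝ≥0) :
    MeasurePreserving (fun (x : τ → ℝ) => ((fun i => x (e (.inl i)), fun i => x (e (.inr i)))))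
      (gaussianPi τ v) ((gaussianPi ι v).prod (gaussianPi κ v)) :=
  (measurePreserving_sumPiEquivProdPi (fun _ : ι ⊕ κ => gaussianReal 0 v)).comp
    (measurePreserving_gaussianPi_equiv e v)

theorem map_sum_sq_gaussianPi (d k : ℕ) (v : ℝ≥0) :
    (gaussianPi (Fin (k + d)) v).map
      (fun x => (∑ i : Fin d, x (Fin.natAdd k i) ^ 2, ∑ i : Fin k, x (Fin.castAdd d i) ^ 2)) =
      (chiSqLaw d v).prod (chiSqLaw k v) := by
  have h := measurePreserving_gaussianPi_sum (finSumFinEquiv (m := k) (n := d)) v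
  rw [chiSqLaw_eq_map_gaussianPi, chiSqLaw_eq_map_gaussianPi,
    Measure.map_prod_map _ _ (by fun_prop) (by fun_prop), ← Measure.prod_swap, ← h.map_eq,
    Measure.map_map (by fun_prop) (by fun_prop), Measure.map_map (by fun_prop) (by fun_prop)]
  rfl

theorem chiSqLaw_zero (v : ℝ≥0) : chiSqLaw 0 v = Measure.dirac 0 := by
  rw [chiSqLaw_eq_map_gaussianPi]
  simp [Measure.map_const]

theorem chiSqLaw_add (d k : ℕ) (v : ℝ≥0) :
    chiSqLaw (k + d) v = ((chiSqLaw d v).prod (chiSqLaw k v)).map fun z => z.1 + z.2 := by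
  rw [← map_sum_sq_gaussianPi, Measure.map_map (by fun_prop) (by fun_prop),
    chiSqLaw_eq_map_gaussianPi]
  congr 1
  ext x
  rw [Fin.sum_univ_add, add_comm]
  rfl

theorem chiSqLaw_one_one : chiSqLaw 1 1 = gammaMeasure (1 / 2) (1 / 2) := by
  rw [← map_sq_gaussianReal, chiSqLaw_eq_map_gaussianPi]
  have := (measurePreserving_funUnique (gaussianReal 0 1) (Fin 1)).map_eq
  rw [← this, Measure.map_map (by fun_prop) (by fun_prop)]
  simp only [gaussianPi]
  congr 1
  ext x
  simp [MeasurableEquiv.funUnique]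

theorem map_add_gammaMeasure_prod {p q r : ℝ} (hp : 0 < p) (hq : 0 < q) (hr : 0 < r) :
    ((gammaMeasure p r).prod (gammaMeasure q r)).map (fun z => z.1 + z.2) =
      gammaMeasure (p + q) r := by
  have := isProbabilityMeasureBeta hp hq
  have := isProbabilityMeasure_gammaMeasure (add_pos hp hq) hr
  have h := congrArg Measure.fst (map_gammaMeasure_prod_gammaMeasure hp hq hr)
  rw [Measure.fst_prod, Measure.fst, Measure.map_map (by fun_prop) (by fun_prop)] at h
  exact h

/-- Unit variance suffices: gamma laws serve only for the beta factor, which comes from an auxiliary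
standard Gaussian vector. -/
theorem chiSqLaw_one_eq_gammaMeasure (n : ℕ) :
    chiSqLaw (n + 1) 1 = gammaMeasure (((n + 1 : ℕ) : ℝ) / 2) (1 / 2) := by
  induction n with
  | zero => simpa using chiSqLaw_one_one
  | succ n ih =>
    rw [chiSqLaw_add, ih, chiSqLaw_one_one,
      map_add_gammaMeasure_prod (by positivity) (by positivity) (by positivity)]
    congr 1
    push_cast
    ring

theorem map_chiSqLaw_ratio (d k : ℕ) (hd : 0 < d) :
    ((chiSqLaw d 1).prod (chiSqLaw k 1)).map (fun z => z.1 / (z.1 + z.2)) =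
      betaLaw ((d : ℝ) / 2) ((k : ℝ) / 2) := by
  obtain ⟨d, rfl⟩ := Nat.exists_eq_succ_of_ne_zero hd.ne'
  rcases k with _ | k
  · rw [chiSqLaw_zero, betaLaw, if_pos (by simp), Measure.prod_dirac,
      Measure.map_map (by fun_prop) (by fun_prop)]
    -- For `k = 0` the ratio is `x / x`, equal to `1` off the null set `x = 0`; this matches the
    -- convention for `betaLaw` at `b = 0`.
    have h : (fun z : ℝ × ℝ => z.1 / (z.1 + z.2)) ∘ (fun x => (x, (0 : ℝ))) =ᵐ[chiSqLaw (d + 1) 1]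
        fun _ => 1 := by
      rw [chiSqLaw_one_eq_gammaMeasure, gammaMeasure]
      have : ∀ᵐ x : ℝ, x ≠ 0 := by simp [ae_iff]
      filter_upwards [(withDensity_absolutelyContinuous _ _).ae_le this] with x hx
      simp [hx]
    rw [Nat.succ_eq_add_one, Measure.map_congr h, Measure.map_const]
    simp
  · rw [Nat.succ_eq_add_one, chiSqLaw_one_eq_gammaMeasure, chiSqLaw_one_eq_gammaMeasure, betaLaw,
      if_neg (by positivity)]
    have hp : (0 : ℝ) < ((d + 1 : ℕ) : ℝ) / 2 := by positivity
    have hq : (0 : ℝ) < ((k + 1 : ℕ) : ℝ) / 2 := by positivity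
    have hr : (0 : ℝ) < 1 / 2 := by norm_num
    have := isProbabilityMeasureBeta hp hq
    have := isProbabilityMeasure_gammaMeasure (add_pos hp hq) hr
    have h := congrArg Measure.snd (map_gammaMeasure_prod_gammaMeasure hp hq hr)
    rw [Measure.snd_prod, Measure.snd, Measure.map_map (by fun_prop) (by fun_prop)] at h
    exact h

theorem map_ratio_gaussianPi (d k : ℕ) (hd : 0 < d) :
    (gaussianPi (Fin (k + d)) 1).map
      (fun x => (∑ i : Fin d, x (Fin.natAdd k i) ^ 2) / ∑ i, x i ^ 2) =
      betaLaw ((d : ℝ) / 2) ((k : ℝ) / 2) := by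
  rw [← map_chiSqLaw_ratio d k hd, ← map_sum_sq_gaussianPi,
    Measure.map_map (by fun_prop) (by fun_prop)]
  congr 1
  ext x
  rw [Fin.sum_univ_add, add_comm (∑ i : Fin k, _)]
  rfl

theorem map_sum_natAdd_sq_gaussianPi (d k : ℕ) (v : ℝ≥0) :
    (gaussianPi (Fin (k + d)) v).map (fun x => ∑ i : Fin d, x (Fin.natAdd k i) ^ 2) =
      chiSqLaw d v := by
  have h := congrArg Measure.fst (map_sum_sq_gaussianPi d k v)
  rw [Measure.fst_prod, Measure.fst, Measure.map_map (by fun_prop) (by fun_prop)] at h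
  exact h

theorem ae_ne_zero_gaussianPi (n : ℕ) : ∀ᵐ x ∂(gaussianPi (Fin (n + 1)) 1), x ≠ 0 := by
  have h : ∀ᵐ x ∂(gaussianPi (Fin (n + 1)) 1), x 0 ≠ 0 := by
    have := measurePreserving_eval (fun _ : Fin (n + 1) => gaussianReal 0 1) 0
    refine this.quasiMeasurePreserving.ae (p := fun x : ℝ => x ≠ 0) ?_
    have := nullSingletonClass_gaussianReal (μ := 0) (v := 1) one_ne_zero
    simp [ae_iff]
  filter_upwards [h] with x hx h0
  simp [h0] at hx

/-! ### Gram determinants and orthogonal changes of basis -/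

/-- Gram–Schmidt on the rows of `G`, padded by zero vectors, yields an orthonormal basis whose last
`d` members are orthogonal to every row. No rank condition is needed, since the basis is completed
in any case. -/
theorem exists_orthogonal_mul_eq_zero {k d : ℕ} (G : Matrix (Fin k) (Fin (k + d)) ℝ) :
    ∃ O : Matrix (Fin (k + d)) (Fin (k + d)) ℝ, Oᵀ * O = 1 ∧
      ∀ r i, (G * Oᵀ) r (Fin.natAdd k i) = 0 := by
  let f : Fin (k + d) → EuclideanSpace ℝ (Fin (k + d)) :=
    Fin.append (fun r => WithLp.toLp 2 (G r)) (fun _ => 0)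
  let b := InnerProductSpace.gramSchmidtOrthonormalBasis (𝕜 := ℝ) (by simp) f
  refine ⟨Matrix.of fun i j => b i j, ?_, fun r i => ?_⟩
  · rw [mul_eq_one_comm]
    ext i j
    have := b.inner_eq_ite j i
    rw [PiLp.inner_apply] at this
    simp only [RCLike.inner_apply, conj_trivial] at this
    simp [Matrix.mul_apply, this, Matrix.one_apply, eq_comm]
  · have h := InnerProductSpace.gramSchmidtOrthonormalBasis_inv_triangular (𝕜 := ℝ)
      (by simp) f (i := Fin.castAdd d r) (j := Fin.natAdd k i) (by simp [Fin.lt_def]; omega)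
    rw [PiLp.inner_apply] at h
    simpa [Matrix.mul_apply, f, b] using h

/-- Only the squared length `s` of the tail of the last row enters the Gram matrix. Replacing that
tail by the single entry `√s` gives a square block triangular matrix with the same Gram matrix. -/
theorem det_mul_conjTranspose_of_eq_zero {k d : ℕ} (M : Matrix (Fin (k + 1)) (Fin (k + d)) ℂ)
    (hM : ∀ r i, M (Fin.castSucc r) (Fin.natAdd k i) = 0) :
    (M * Mᴴ).det = (M.submatrix Fin.castSucc id * (M.submatrix Fin.castSucc id)ᴴ).det *
      ((∑ i : Fin d, Complex.normSq (M (Fin.last k) (Fin.natAdd k i)) : ℝ) : ℂ) := by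
  set s : ℝ := ∑ i : Fin d, Complex.normSq (M (Fin.last k) (Fin.natAdd k i)) with hs
  have s0 : 0 ≤ s := Finset.sum_nonneg fun i _ => Complex.normSq_nonneg _
  let L : Matrix (Fin k) (Fin k) ℂ := Matrix.of fun r j => M (Fin.castSucc r) (Fin.castAdd d j)
  let y : Matrix (Fin 1) (Fin k) ℂ := Matrix.of fun _ j => M (Fin.last k) (Fin.castAdd d j)
  let t : Matrix (Fin 1) (Fin 1) ℂ := Matrix.of fun _ _ => ((√s : ℝ) : ℂ)
  let N := Matrix.fromBlocks L 0 y t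
  have hst : ((√s : ℝ) : ℂ) * ((√s : ℝ) : ℂ) = (s : ℂ) := by
    rw [← Complex.ofReal_mul, Real.mul_self_sqrt s0]
  have hN : (M * Mᴴ).submatrix finSumFinEquiv finSumFinEquiv = N * Nᴴ := by
    have e1 : ∀ i : Fin 1, Fin.natAdd k i = Fin.last k := fun i => by
      ext; simp
    have e2 : ∀ i : Fin k, Fin.castAdd 1 i = i.castSucc := fun _ => rfl
    rw [Matrix.fromBlocks_conjTranspose, Matrix.fromBlocks_multiply]
    ext (i | i) (j | j)
    · simp [Matrix.mul_apply, Fin.sum_univ_add, L, hM, e2]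
    · simp [Matrix.mul_apply, Fin.sum_univ_add, L, hM, y, e1, e2]
    · simp [Matrix.mul_apply, Fin.sum_univ_add, L, hM, y, e1, e2]
    · simp [Matrix.mul_apply, Fin.sum_univ_add, y, t, e1, hst, Complex.mul_conj]
      simp [hs]
  have hL : M.submatrix Fin.castSucc id * (M.submatrix Fin.castSucc id)ᴴ = L * Lᴴ := by
    ext i j
    simp [Matrix.mul_apply, Fin.sum_univ_add, L, hM]
  rw [← Matrix.det_submatrix_equiv_self finSumFinEquiv, hN, hL, Matrix.det_mul, Matrix.det_mul,
    Matrix.det_conjTranspose, Matrix.det_conjTranspose, Matrix.det_fromBlocks_zero₁₂]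
  have ht : t.det = ((√s : ℝ) : ℂ) := by simp [t]
  rw [ht, ← hst, star_mul']
  simp only [RCLike.star_def, Complex.conj_ofReal]
  ring

/-- The determinant of the Gram matrix of the rows of a real matrix. -/
noncomputable def gramDet {m n : ℕ} (φ : Fin m × Fin n → ℝ) : ℝ :=
  (Matrix.of (Function.curry φ) * (Matrix.of (Function.curry φ))ᵀ).det

/-- The complex matrix with rows `j G` followed by the row `a + j b`. -/
noncomputable def shiftedLastRow {k n : ℕ} (G : Fin k × Fin n → ℝ) (b a : Fin n → ℝ) :
    Matrix (Fin (k + 1)) (Fin n) ℂ :=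
  Matrix.of fun r j =>
    Fin.lastCases (a j + Complex.I * b j) (fun i => Complex.I * (G (i, j) : ℂ)) r

/-- The determinant of the Gram matrix of the rows of `shiftedLastRow G b a`. -/
noncomputable def shiftedDet {k n : ℕ} (G : Fin k × Fin n → ℝ) (b a : Fin n → ℝ) : ℂ :=
  (shiftedLastRow G b a * (shiftedLastRow G b a)ᴴ).det

theorem map_ofReal_mul_map_ofReal_eq_one {n : ℕ} {A B : Matrix (Fin n) (Fin n) ℝ}
    (h : A * B = 1) : A.map Complex.ofReal * B.map Complex.ofReal = 1 := by
  have := congrArg (fun A => Matrix.map A Complex.ofRealHom) h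
  simp only [Matrix.map_mul, Matrix.map_one _ (map_zero _) (map_one _)] at this
  exact this

theorem mul_conjTranspose_of_orthogonal {m n : ℕ} (M : Matrix (Fin m) (Fin n) ℂ)
    {O : Matrix (Fin n) (Fin n) ℝ} (hO : Oᵀ * O = 1) :
    (M * Oᵀ.map Complex.ofReal) * (M * Oᵀ.map Complex.ofReal)ᴴ = M * Mᴴ := by
  have h1 : (Oᵀ.map Complex.ofReal)ᴴ = O.map Complex.ofReal := by
    ext i j
    simp
  rw [Matrix.conjTranspose_mul, h1, Matrix.mul_assoc, ← Matrix.mul_assoc (Oᵀ.map _),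
    map_ofReal_mul_map_ofReal_eq_one hO,
    Matrix.one_mul]

/-- Apply a matrix to every row. -/
def rotateRows {m n : ℕ} (O : Matrix (Fin n) (Fin n) ℝ) :
    (Fin m × Fin n → ℝ) →ₗ[ℝ] (Fin m × Fin n → ℝ) where
  toFun φ p := ∑ l, O p.2 l * φ (p.1, l)
  map_add' φ ψ := by ext p; simp [mul_add, Finset.sum_add_distrib]
  map_smul' c φ := by ext p; simp [Finset.mul_sum, mul_left_comm]

theorem shiftedLastRow_mul {k n : ℕ} (G : Fin k × Fin n → ℝ) (b a : Fin n → ℝ)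
    (O : Matrix (Fin n) (Fin n) ℝ) :
    shiftedLastRow G b a * Oᵀ.map Complex.ofReal =
      shiftedLastRow (rotateRows O G) (O *ᵥ b) (O *ᵥ a) := by
  ext r j
  refine Fin.lastCases ?_ (fun i => ?_) r
  · simp [shiftedLastRow, Matrix.mul_apply, Matrix.mulVec, dotProduct, add_mul,
      Finset.sum_add_distrib, Finset.mul_sum, mul_comm (Complex.ofReal (O _ _)), mul_assoc]
  · simp [shiftedLastRow, Matrix.mul_apply, rotateRows, Finset.mul_sum, mul_comm, mul_left_comm]

theorem shiftedDet_rotate {k n : ℕ} (G : Fin k × Fin n → ℝ) (b a : Fin n → ℝ)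
    {O : Matrix (Fin n) (Fin n) ℝ} (hO : Oᵀ * O = 1) :
    shiftedDet (rotateRows O G) (O *ᵥ b) (O *ᵥ a) = shiftedDet G b a := by
  rw [shiftedDet, ← shiftedLastRow_mul, mul_conjTranspose_of_orthogonal _ hO, shiftedDet]

theorem ofReal_gramDet {m n : ℕ} (φ : Fin m × Fin n → ℝ) (M : Matrix (Fin m) (Fin n) ℂ)
    (hM : ∀ i j, M i j = Complex.I * φ (i, j)) : (M * Mᴴ).det = gramDet φ := by
  have h : M * Mᴴ = (Matrix.of (Function.curry φ) * (Matrix.of (Function.curry φ))ᵀ).map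
      Complex.ofRealHom := by
    ext i j
    simp only [Matrix.mul_apply, Matrix.conjTranspose_apply, hM, Matrix.map_apply,
      Matrix.transpose_apply, Matrix.of_apply, Function.curry, map_sum, map_mul, star_mul',
      RCLike.star_def, Complex.conj_I, Complex.conj_ofReal, Complex.ofRealHom_eq_coe]
    refine Finset.sum_congr rfl fun l _ => ?_
    linear_combination (-(φ (i, l) : ℂ) * (φ (j, l) : ℂ)) * Complex.I_mul_I
  rw [h, gramDet]
  exact (RingHom.map_det _ _).symm

/-- `O` depends on `G` alone, so one choice serves while integrating over `b` and `a`. It need not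
be measurable in `G`, because the inner integrals turn out not to involve `O`. -/
theorem exists_orthogonal_shiftedDet_eq {k d : ℕ} (G : Fin k × Fin (k + d) → ℝ) :
    ∃ O : Matrix (Fin (k + d)) (Fin (k + d)) ℝ, Oᵀ * O = 1 ∧ ∀ b a,
      shiftedDet G b a = ((gramDet G * (∑ i : Fin d, (O *ᵥ b) (Fin.natAdd k i) ^ 2 +
        ∑ i : Fin d, (O *ᵥ a) (Fin.natAdd k i) ^ 2) : ℝ) : ℂ) := by
  obtain ⟨O, hO, h⟩ := exists_orthogonal_mul_eq_zero (Matrix.of (Function.curry G))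
  refine ⟨O, hO, fun b a => ?_⟩
  have hz : ∀ r i, rotateRows O G (r, Fin.natAdd k i) = 0 := by
    intro r i
    rw [← h r i]
    simp [rotateRows, Matrix.mul_apply, mul_comm]
  have hg : (shiftedLastRow G b a).submatrix Fin.castSucc id *
      ((shiftedLastRow G b a).submatrix Fin.castSucc id)ᴴ =
      (shiftedLastRow (rotateRows O G) (O *ᵥ b) (O *ᵥ a)).submatrix Fin.castSucc id *
      ((shiftedLastRow (rotateRows O G) (O *ᵥ b) (O *ᵥ a)).submatrix Fin.castSucc id)ᴴ := by
    rw [← shiftedLastRow_mul, ← mul_conjTranspose_of_orthogonal _ hO]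
    rfl
  rw [← shiftedDet_rotate G b a hO, shiftedDet, det_mul_conjTranspose_of_eq_zero _
    (fun r i => by simp [shiftedLastRow, hz]), ← hg,
    ofReal_gramDet G _ (fun i j => by simp [shiftedLastRow]), ← Finset.sum_add_distrib]
  push_cast
  congr 1
  refine Finset.sum_congr rfl fun i _ => ?_
  rw [← Complex.ofReal_pow, ← Complex.ofReal_pow, ← Complex.ofReal_add]
  congr 1
  simp [shiftedLastRow, Complex.normSq_apply]
  ring

theorem gramDet_succ {k n : ℕ} (φ : Fin (k + 1) × Fin n → ℝ) :
    (gramDet φ : ℂ) =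
      shiftedDet (fun p => φ (p.1.castSucc, p.2)) (fun j => φ (Fin.last k, j)) 0 := by
  rw [shiftedDet, ← ofReal_gramDet φ]
  intro i j
  refine Fin.lastCases ?_ (fun i => ?_) i <;> simp [shiftedLastRow]

/-- For `a ≠ b` of equal length, the Householder reflection in the hyperplane orthogonal to `a - b`
works. -/
theorem exists_orthogonal_mulVec_eq {ι : Type*} [Fintype ι] [DecidableEq ι] {a b : ι → ℝ}
    (hab : ∑ i, a i ^ 2 = ∑ i, b i ^ 2) :
    ∃ R : Matrix ι ι ℝ, Rᵀ * R = 1 ∧ R *ᵥ a = b := by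
  by_cases h : a = b
  · exact ⟨1, by simp, by simp [h]⟩
  have hab' : a ⬝ᵥ a = b ⬝ᵥ b := by simpa [dotProduct, ← sq] using hab
  set u := a - b with hu
  have hc : u ⬝ᵥ u ≠ 0 := by
    rw [Ne, dotProduct_self_eq_zero, hu, sub_eq_zero]
    exact h
  have huu : u ⬝ᵥ u = 2 * (u ⬝ᵥ a) := by
    simp only [hu, sub_dotProduct, dotProduct_sub]
    rw [dotProduct_comm a b, hab']
    ring
  set c : ℝ := 2 / (u ⬝ᵥ u) with hcd
  have e : (c • Matrix.vecMulVec u u) * (c • Matrix.vecMulVec u u) =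
      (2 : ℝ) • (c • Matrix.vecMulVec u u) := by
    rw [Matrix.smul_mul, Matrix.mul_smul, Matrix.vecMulVec_mul_vecMulVec, smul_smul, smul_smul]
    ext i j
    simp [Matrix.vecMulVec_apply]
    field_simp
    rw [hcd]
    field_simp
  refine ⟨1 - c • Matrix.vecMulVec u u, ?_, ?_⟩
  · have ht : (1 - c • Matrix.vecMulVec u u)ᵀ = 1 - c • Matrix.vecMulVec u u := by
      simp [Matrix.transpose_vecMulVec]
    rw [ht, sub_mul, mul_sub, mul_sub, e]
    simp [two_smul]
  · ext i
    have : c * (u ⬝ᵥ a) = 1 := by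
      rw [hcd, huu]
      have : u ⬝ᵥ a ≠ 0 := fun h0 => hc (by rw [huu, h0, mul_zero])
      field_simp
    simp only [Matrix.sub_mulVec, Matrix.one_mulVec, Matrix.smul_mulVec, Matrix.vecMulVec_mulVec,
      Pi.sub_apply, Pi.smul_apply, smul_eq_mul, MulOpposite.smul_eq_mul_unop, MulOpposite.unop_op]
    have hui : u i = a i - b i := rfl
    linear_combination (-(u i)) * this - hui

/-! ### Rotations of Gaussian matrices -/

/-- Apply a matrix to every column. -/
def rotateColumns {m n : ℕ} (Q : Matrix (Fin m) (Fin m) ℝ) :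
    (Fin m × Fin n → ℝ) →ₗ[ℝ] (Fin m × Fin n → ℝ) where
  toFun φ p := ∑ l, Q p.1 l * φ (l, p.2)
  map_add' φ ψ := by ext p; simp [mul_add, Finset.sum_add_distrib]
  map_smul' c φ := by ext p; simp [Finset.mul_sum, mul_left_comm]

theorem sum_mulVec_sq {n : ℕ} {O : Matrix (Fin n) (Fin n) ℝ} (hO : Oᵀ * O = 1) (x : Fin n → ℝ) :
    ∑ i, (O *ᵥ x) i ^ 2 = ∑ i, x i ^ 2 := by
  have h : (O *ᵥ x) ⬝ᵥ (O *ᵥ x) = x ⬝ᵥ x := by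
    rw [Matrix.dotProduct_mulVec, Matrix.vecMul_mulVec, ← Matrix.mulVec_transpose,
      Matrix.transpose_mul, Matrix.transpose_transpose, hO, Matrix.one_mulVec]
  simpa [dotProduct, ← sq] using h

theorem map_rotateRows_gaussianPi {m n : ℕ} {O : Matrix (Fin n) (Fin n) ℝ} (hO : Oᵀ * O = 1)
    (v : ℝ≥0) : (gaussianPi (Fin m × Fin n) v).map (rotateRows O) = gaussianPi _ v := by
  refine map_gaussianPi_of_sum_sq_eq v _ fun φ => ?_
  rw [Fintype.sum_prod_type, Fintype.sum_prod_type]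
  exact Finset.sum_congr rfl fun i _ => sum_mulVec_sq hO fun l => φ (i, l)

theorem map_rotateColumns_gaussianPi {m n : ℕ} {Q : Matrix (Fin m) (Fin m) ℝ} (hQ : Qᵀ * Q = 1)
    (v : ℝ≥0) : (gaussianPi (Fin m × Fin n) v).map (rotateColumns Q) = gaussianPi _ v := by
  refine map_gaussianPi_of_sum_sq_eq v _ fun φ => ?_
  rw [Fintype.sum_prod_type_right, Fintype.sum_prod_type_right]
  exact Finset.sum_congr rfl fun j _ => sum_mulVec_sq hQ fun l => φ (l, j)

theorem map_mulVec_gaussianPi {n : ℕ} {O : Matrix (Fin n) (Fin n) ℝ} (hO : Oᵀ * O = 1)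
    (v : ℝ≥0) : (gaussianPi (Fin n) v).map (fun x => O *ᵥ x) = gaussianPi _ v :=
  map_gaussianPi_of_sum_sq_eq v O.mulVecLin (sum_mulVec_sq hO)

theorem exists_orthogonal_det_thetaTilde (k n : ℕ) :
    ∃ Q : Matrix (Fin (k + 1)) (Fin (k + 1)) ℝ, Qᵀ * Q = 1 ∧
      ∀ φ : Fin (k + 1) × Fin n → ℝ,
        (thetaTilde (Matrix.of (Function.curry φ)) *
          (thetaTilde (Matrix.of (Function.curry φ)))ᴴ).det =
        shiftedDet (fun p => rotateColumns Q φ (p.1.castSucc, p.2))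
          (fun j => rotateColumns Q φ (Fin.last k, j)) (fun _ => √(k + 1)) := by
  -- The all-ones column has length `√(k + 1)`, so it can be rotated onto the last axis; the mean
  -- then sits in the last row only.
  obtain ⟨Q, hQ, h1⟩ := exists_orthogonal_mulVec_eq (a := fun _ : Fin (k + 1) => (1 : ℝ))
    (b := Pi.single (Fin.last k) √(k + 1)) (by
      rw [Finset.sum_eq_single (Fin.last k)
        (f := fun i => Pi.single (M := fun _ => ℝ) (Fin.last k) √(k + 1) i ^ 2)]
      · simp only [Pi.single_eq_same]
        rw [Real.sq_sqrt (by positivity)]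
        simp
      · intro i _ hi
        simp [hi]
      · simp)
  refine ⟨Q, hQ, fun φ => ?_⟩
  set T := thetaTilde (Matrix.of (Function.curry φ)) with hT
  set C : Matrix (Fin (k + 1)) (Fin (k + 1)) ℂ := Q.map Complex.ofReal with hC
  have hrow : ∀ i, ∑ l, (Q i l : ℂ) = if i = Fin.last k then ((√(k + 1) : ℝ) : ℂ) else 0 := by
    intro i
    have := congrFun h1 i
    simp only [Matrix.mulVec, dotProduct, mul_one, Pi.single_apply] at this
    rw [← Complex.ofReal_sum, this]
    split_ifs <;> simp
  have hS : C * T = shiftedLastRow (fun p => rotateColumns Q φ (p.1.castSucc, p.2))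
          (fun j => rotateColumns Q φ (Fin.last k, j)) (fun _ => √(k + 1)) := by
    ext i j
    have : (C * T) i j = (∑ l, (Q i l : ℂ)) + Complex.I * (rotateColumns Q φ (i, j) : ℂ) := by
      simp [hC, hT, thetaTilde, Matrix.mul_apply, mul_add, Finset.sum_add_distrib, rotateColumns,
        Finset.mul_sum, mul_left_comm, Function.curry]
    rw [this, hrow]
    refine Fin.lastCases ?_ (fun i => ?_) i
    · simp [shiftedLastRow]
    · simp [shiftedLastRow, (Fin.castSucc_lt_last i).ne]
  have hdet : C.det * Cᴴ.det = 1 := by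
    have h2 : C * Cᴴ = 1 := by
      have h3 : Cᴴ = Qᵀ.map Complex.ofReal := by ext i j; simp [hC]
      rw [h3]
      exact map_ofReal_mul_map_ofReal_eq_one (mul_eq_one_comm.1 hQ)
    rw [← Matrix.det_mul, h2, Matrix.det_one]
  rw [shiftedDet, ← hS, Matrix.conjTranspose_mul, Matrix.mul_assoc, ← Matrix.mul_assoc T,
    Matrix.det_mul, Matrix.det_mul]
  linear_combination (-(T * Tᴴ).det) * hdet

/-! ### Measurability and integration over the last row -/

theorem measurable_gramDet {m n : ℕ} : Measurable (gramDet : (Fin m × Fin n → ℝ) → ℝ) := by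
  refine Continuous.measurable ?_
  unfold gramDet
  refine Continuous.matrix_det (Continuous.matrix_mul ?_ (Continuous.matrix_transpose ?_)) <;>
  · refine continuous_matrix fun i j => ?_
    simp only [Matrix.of_apply, Function.curry]
    fun_prop

theorem continuous_shiftedDet {k n : ℕ} : Continuous
    (fun z : (Fin k × Fin n → ℝ) × (Fin n → ℝ) × (Fin n → ℝ) => shiftedDet z.1 z.2.1 z.2.2) := by
  have h : Continuous (fun z : (Fin k × Fin n → ℝ) × (Fin n → ℝ) × (Fin n → ℝ) =>
      shiftedLastRow z.1 z.2.1 z.2.2) := by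
    refine continuous_matrix fun i j => ?_
    refine Fin.lastCases ?_ (fun i => ?_) i
    · simp only [shiftedLastRow, Matrix.of_apply, Fin.lastCases_last]
      fun_prop
    · simp only [shiftedLastRow, Matrix.of_apply, Fin.lastCases_castSucc]
      fun_prop
  unfold shiftedDet
  exact Continuous.matrix_det (Continuous.matrix_mul h (Continuous.matrix_conjTranspose h))

theorem measurable_shiftedDet {k n : ℕ} {α : Type*} [MeasurableSpace α]
    {f : α → Fin k × Fin n → ℝ} {g h : α → Fin n → ℝ} (hf : Measurable f) (hg : Measurable g)
    (hh : Measurable h) : Measurable fun x => shiftedDet (f x) (g x) (h x) := by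
  have hc : Measurable (fun z : (Fin k × Fin n → ℝ) × (Fin n → ℝ) × (Fin n → ℝ) =>
    shiftedDet z.1 z.2.1 z.2.2) := continuous_shiftedDet.measurable
  have := hc.comp (hf.prodMk (hg.prodMk hh))
  exact this

/-- Separating the last row from the other rows. -/
def rowsEquiv (k n : ℕ) : (Fin k × Fin n) ⊕ Fin n ≃ Fin (k + 1) × Fin n where
  toFun := Sum.elim (fun p => (p.1.castSucc, p.2)) (fun j => (Fin.last k, j))
  invFun p := Fin.lastCases (Sum.inr p.2) (fun i => Sum.inl (i, p.2)) p.1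
  left_inv := by rintro (⟨i, j⟩ | j) <;> simp
  right_inv := by
    rintro ⟨i, j⟩
    refine Fin.lastCases ?_ (fun i => ?_) i <;> simp

theorem measurePreserving_splitRows (k n : ℕ) (v : ℝ≥0) :
    MeasurePreserving (fun φ : Fin (k + 1) × Fin n → ℝ =>
      ((fun p : Fin k × Fin n => φ (p.1.castSucc, p.2)), fun j => φ (Fin.last k, j)))
      (gaussianPi _ v) ((gaussianPi _ v).prod (gaussianPi _ v)) :=
  measurePreserving_gaussianPi_sum (rowsEquiv k n) v

theorem lintegral_gaussianPi_succ {k n : ℕ} (v : ℝ≥0)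
    {f : (Fin k × Fin n → ℝ) → (Fin n → ℝ) → ENNReal} (hf : Measurable (Function.uncurry f)) :
    ∫⁻ φ, f (fun p => φ (p.1.castSucc, p.2)) (fun j => φ (Fin.last k, j))
        ∂(gaussianPi (Fin (k + 1) × Fin n) v) =
      ∫⁻ G, ∫⁻ b, f G b ∂(gaussianPi _ v) ∂(gaussianPi _ v) := by
  rw [← lintegral_prod (fun z => f z.1 z.2) hf.aemeasurable]
  exact (measurePreserving_splitRows k n v).lintegral_comp hf

theorem lintegral_sum_natAdd_mulVec {k d : ℕ} (v : ℝ≥0)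
    {O : Matrix (Fin (k + d)) (Fin (k + d)) ℝ} (hO : Oᵀ * O = 1) {f : ℝ → ENNReal}
    (hf : Measurable f) :
    ∫⁻ b, f (∑ i : Fin d, (O *ᵥ b) (Fin.natAdd k i) ^ 2) ∂(gaussianPi _ v) =
      ∫⁻ x, f x ∂(chiSqLaw d v) := by
  have mO : Measurable fun b : Fin (k + d) → ℝ => O *ᵥ b :=
    (Continuous.matrix_mulVec continuous_const continuous_id).measurable
  rw [← map_sum_natAdd_sq_gaussianPi d k v, lintegral_map hf (by fun_prop)]
  conv_rhs => rw [← map_mulVec_gaussianPi hO v]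
  rw [lintegral_map (by fun_prop) mO]

theorem lintegral_sum_natAdd_mulVec_ratio {k d : ℕ} (hd : 0 < d)
    {O : Matrix (Fin (k + d)) (Fin (k + d)) ℝ} (hO : Oᵀ * O = 1) {f : ℝ → ENNReal}
    (hf : Measurable f) :
    ∫⁻ h, f ((∑ i : Fin d, (O *ᵥ h) (Fin.natAdd k i) ^ 2) / ∑ i, h i ^ 2) ∂(gaussianPi _ 1) =
      ∫⁻ x, f x ∂(betaLaw ((d : ℝ) / 2) ((k : ℝ) / 2)) := by
  have mO : Measurable fun b : Fin (k + d) → ℝ => O *ᵥ b :=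
    (Continuous.matrix_mulVec continuous_const continuous_id).measurable
  rw [← map_ratio_gaussianPi d k hd, lintegral_map hf (by fun_prop)]
  conv_rhs => rw [← map_mulVec_gaussianPi hO 1]
  rw [lintegral_map (by fun_prop) mO]
  simp_rw [sum_mulVec_sq hO]

/-! ### Laws of the Gram determinants -/

theorem map_gramDet_gaussianPi (n : ℕ) (v : ℝ≥0) {k : ℕ} (hk : k ≤ n) :
    (gaussianPi (Fin k × Fin n) v).map gramDet =
      (Measure.pi fun i : Fin k => chiSqLaw (n - i) v).map fun z => ∏ i, z i := by
  induction k with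
  | zero =>
    have : (gramDet : (Fin 0 × Fin n → ℝ) → ℝ) = fun _ => 1 := by
      ext φ; simp [gramDet]
    simp [this, Measure.map_const]
  | succ k ih =>
    -- Here `d = n - k` is the codimension of `k` generic rows, hence the degrees of freedom
    -- contributed by the new row.
    obtain ⟨d, rfl⟩ := Nat.exists_eq_add_of_le (Nat.le_of_succ_le hk)
    refine Measure.ext_of_lintegral _ fun f hf => ?_
    have hsplit := (measurePreserving_piFinSuccAbove
      (fun i : Fin (k + 1) => chiSqLaw (k + d - i) v) (Fin.last k))
    have mg : Measurable (gramDet : (Fin k × Fin (k + d) → ℝ) → ℝ) := measurable_gramDet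
    calc ∫⁻ x, f x ∂((gaussianPi (Fin (k + 1) × Fin (k + d)) v).map gramDet)
        = ∫⁻ G, ∫⁻ b, f (shiftedDet G b 0).re ∂(gaussianPi _ v)
            ∂(gaussianPi (Fin k × Fin (k + d)) v) := by
          rw [lintegral_map hf measurable_gramDet, ← lintegral_gaussianPi_succ v
            (f := fun G b => f (shiftedDet G b 0).re)
            (hf.comp (Complex.measurable_re.comp
              (measurable_shiftedDet (by fun_prop) (by fun_prop) (by fun_prop))))]
          simp_rw [← gramDet_succ, Complex.ofReal_re]
      _ = ∫⁻ G, ∫⁻ x, f (gramDet G * x) ∂(chiSqLaw d v)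
            ∂(gaussianPi (Fin k × Fin (k + d)) v) := by
          refine lintegral_congr fun G => ?_
          obtain ⟨O, hO, h⟩ := exists_orthogonal_shiftedDet_eq G
          rw [← lintegral_sum_natAdd_mulVec (k := k) v hO (by fun_prop)]
          refine lintegral_congr fun b => ?_
          rw [h, Complex.ofReal_re]
          simp
      _ = ∫⁻ x, ∫⁻ z, f ((∏ i, z i) * x) ∂(Measure.pi fun i : Fin k => chiSqLaw (k + d - i) v)
            ∂(chiSqLaw d v) := by
          rw [lintegral_lintegral_swap (by fun_prop)]
          refine lintegral_congr fun x => ?_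
          rw [← lintegral_map (f := fun y => f (y * x)) (by fun_prop) mg,
            ih (Nat.le_of_succ_le hk), lintegral_map (by fun_prop) (by fun_prop)]
      _ = ∫⁻ x, f x ∂((Measure.pi fun i : Fin (k + 1) => chiSqLaw (k + d - i) v).map
            fun z => ∏ i, z i) := by
          rw [lintegral_map hf (by fun_prop)]
          have e : ∀ z : Fin (k + 1) → ℝ, f (∏ i, z i) =
              (fun w : ℝ × (Fin k → ℝ) => f ((∏ i, w.2 i) * w.1))
                (MeasurableEquiv.piFinSuccAbove (fun _ => ℝ) (Fin.last k) z) := by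
            intro z
            simp [Fin.prod_univ_castSucc, MeasurableEquiv.piFinSuccAbove, Fin.init]
          have m : Measurable fun w : ℝ × (Fin k → ℝ) => f ((∏ i, w.2 i) * w.1) := by fun_prop
          rw [lintegral_congr e]
          refine Eq.trans ?_ (hsplit.lintegral_comp m).symm
          rw [lintegral_prod _ m.aemeasurable]
          simp

/-- Rotating all rows at once preserves the determinant and the laws of `G` and `b`, while moving
`a` to any vector of the same length. -/
theorem lintegral_shiftedDet_eq_of_sum_sq_eq {k n : ℕ} (v : ℝ≥0) {f : ℂ → ENNReal}
    (hf : Measurable f) {a a' : Fin n → ℝ} (h : ∑ i, a i ^ 2 = ∑ i, a' i ^ 2) :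
    ∫⁻ G, ∫⁻ b, f (shiftedDet G b a) ∂(gaussianPi _ v) ∂(gaussianPi (Fin k × Fin n) v) =
      ∫⁻ G, ∫⁻ b, f (shiftedDet G b a') ∂(gaussianPi _ v) ∂(gaussianPi (Fin k × Fin n) v) := by
  obtain ⟨R, hR, rfl⟩ := exists_orthogonal_mulVec_eq h
  have mR : Measurable fun b : Fin n → ℝ => R *ᵥ b :=
    (Continuous.matrix_mulVec continuous_const continuous_id).measurable
  have mR' : Measurable (rotateRows R : (Fin k × Fin n → ℝ) →ₗ[ℝ] _) :=
    (LinearMap.continuous_of_finiteDimensional _).measurable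
  conv_rhs => rw [← map_rotateRows_gaussianPi hR v]
  have m1 : Measurable fun z : (Fin k × Fin n → ℝ) × (Fin n → ℝ) =>
      f (shiftedDet z.1 z.2 (R *ᵥ a)) := hf.comp
    (measurable_shiftedDet (by fun_prop) (by fun_prop) (by fun_prop))
  rw [lintegral_map m1.lintegral_prod_right' mR']
  refine lintegral_congr fun G => ?_
  conv_rhs => rw [← map_mulVec_gaussianPi hR v]
  have m2 : Measurable fun b => f (shiftedDet (rotateRows R G) b (R *ᵥ a)) :=
    hf.comp (measurable_shiftedDet (by fun_prop) (by fun_prop) (by fun_prop))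
  rw [lintegral_map m2 mR]
  simp_rw [shiftedDet_rotate _ _ _ hR]

theorem isProbabilityMeasure_betaLaw_half {k d : ℕ} (hd : 0 < d) :
    IsProbabilityMeasure (betaLaw ((d : ℝ) / 2) ((k : ℝ) / 2)) :=
  isProbabilityMeasure_betaLaw (by positivity) (by positivity)

theorem lintegral_shiftedDet {k d : ℕ} (hd : 0 < d) (v : ℝ≥0) {f : ℂ → ENNReal}
    (hf : Measurable f) (a : Fin (k + d) → ℝ) :
    ∫⁻ G, ∫⁻ b, f (shiftedDet G b a) ∂(gaussianPi _ v) ∂(gaussianPi (Fin k × Fin (k + d)) v) =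
      ∫⁻ G, ∫⁻ x, ∫⁻ y, f ((gramDet G * (x + (∑ i, a i ^ 2) * y) : ℝ) : ℂ)
        ∂(betaLaw ((d : ℝ) / 2) ((k : ℝ) / 2)) ∂(chiSqLaw d v)
        ∂(gaussianPi (Fin k × Fin (k + d)) v) := by
  have := isProbabilityMeasure_betaLaw_half (k := k) hd
  set c : ℝ := ∑ i, a i ^ 2 with hc
  have hc0 : 0 ≤ c := Finset.sum_nonneg fun i _ => sq_nonneg _
  -- The vector `h` rescaled to the length of `a`; this fails only at `h = 0`, a null event as `d >
  -- 0`.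
  let w : (Fin (k + d) → ℝ) → Fin (k + d) → ℝ := fun h i => √(c / ∑ j, h j ^ 2) * h i
  have mw : Measurable w := by
    refine measurable_pi_lambda _ fun i => ?_
    fun_prop
  have hae : ∀ᵐ h ∂(gaussianPi (Fin (k + d)) 1), h ≠ 0 := by
    obtain ⟨e, rfl⟩ := Nat.exists_eq_succ_of_ne_zero hd.ne'
    exact ae_ne_zero_gaussianPi (k + e)
  calc ∫⁻ G, ∫⁻ b, f (shiftedDet G b a) ∂(gaussianPi _ v) ∂(gaussianPi (Fin k × Fin (k + d)) v)
      = ∫⁻ h, ∫⁻ G, ∫⁻ b, f (shiftedDet G b (w h)) ∂(gaussianPi _ v)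
          ∂(gaussianPi (Fin k × Fin (k + d)) v) ∂(gaussianPi (Fin (k + d)) 1) := by
        -- Multiplying by the total mass `1` introduces the dummy variable `h`; `a` may then be
        -- replaced by `w h` for almost every `h`.
        rw [← mul_one (lintegral _ _), ← measure_univ (μ := gaussianPi (Fin (k + d)) 1),
          ← lintegral_const]
        refine lintegral_congr_ae ?_
        filter_upwards [hae] with h hh
        refine lintegral_shiftedDet_eq_of_sum_sq_eq v hf ?_
        have hpos : ∑ j, h j ^ 2 ≠ 0 := by
          intro h0
          refine hh (funext fun j => ?_)
          have := (Finset.sum_eq_zero_iff_of_nonneg (fun i _ => sq_nonneg (h i))).1 h0 j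
            (Finset.mem_univ j)
          simpa using this
        simp_rw [w, mul_pow]
        rw [← Finset.mul_sum, Real.sq_sqrt (by positivity), div_mul_cancel₀ _ hpos]
    -- Moving `h` innermost freezes `G`, so the projected fraction of `h` has a beta law that does
    -- not depend on `G` or `b`.
    _ = ∫⁻ G, ∫⁻ b, ∫⁻ h, f (shiftedDet G b (w h)) ∂(gaussianPi (Fin (k + d)) 1)
          ∂(gaussianPi _ v) ∂(gaussianPi (Fin k × Fin (k + d)) v) := by
        have m1 : Measurable fun z : ((Fin (k + d) → ℝ) × (Fin k × Fin (k + d) → ℝ)) ×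
            (Fin (k + d) → ℝ) => f (shiftedDet z.1.2 z.2 (w z.1.1)) := hf.comp
          (measurable_shiftedDet (by fun_prop) (by fun_prop) (by fun_prop))
        rw [lintegral_lintegral_swap m1.lintegral_prod_right'.aemeasurable]
        refine lintegral_congr fun G => ?_
        have m2 : Measurable fun z : (Fin (k + d) → ℝ) × (Fin (k + d) → ℝ) =>
            f (shiftedDet G z.2 (w z.1)) := hf.comp
          (measurable_shiftedDet (by fun_prop) (by fun_prop) (by fun_prop))
        exact lintegral_lintegral_swap m2.aemeasurable
    _ = _ := by
        refine lintegral_congr fun G => ?_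
        obtain ⟨O, hO, h⟩ := exists_orthogonal_shiftedDet_eq G
        rw [← lintegral_sum_natAdd_mulVec (k := k) v hO
          (f := fun x => ∫⁻ y, f ((gramDet G * (x + c * y) : ℝ) : ℂ)
            ∂(betaLaw ((d : ℝ) / 2) ((k : ℝ) / 2)))
          (Measurable.lintegral_prod_right' (f := fun z : ℝ × ℝ =>
            f ((gramDet G * (z.1 + c * z.2) : ℝ) : ℂ)) (hf.comp (by fun_prop)))]
        refine lintegral_congr fun b => ?_
        rw [← lintegral_sum_natAdd_mulVec_ratio hd hO (f := fun y => f ((gramDet G *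
          (∑ i : Fin d, (O *ᵥ b) (Fin.natAdd k i) ^ 2 + c * y) : ℝ) : ℂ)) (hf.comp (by fun_prop))]
        refine lintegral_congr fun x => ?_
        rw [h]
        congr 5
        have : O *ᵥ w x = √(c / ∑ j, x j ^ 2) • (O *ᵥ x) := by
          rw [← Matrix.mulVec_smul]
          rfl
        simp_rw [this, Pi.smul_apply, smul_eq_mul, mul_pow]
        rw [← Finset.mul_sum, Real.sq_sqrt (div_nonneg hc0
          (Finset.sum_nonneg fun i _ => sq_nonneg _))]
        ring

/-- `shiftedDet` with the random rows collected in one matrix. -/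
noncomputable def shiftedRowsDet {k n : ℕ} (a : Fin n → ℝ) (φ : Fin (k + 1) × Fin n → ℝ) : ℂ :=
  shiftedDet (fun p => φ (p.1.castSucc, p.2)) (fun j => φ (Fin.last k, j)) a

theorem measurable_shiftedRowsDet {k n : ℕ} (a : Fin n → ℝ) :
    Measurable (shiftedRowsDet a : (Fin (k + 1) × Fin n → ℝ) → ℂ) := by
  unfold shiftedRowsDet
  exact measurable_shiftedDet (by fun_prop) (by fun_prop) (by fun_prop)

/-- The determinant of the Gram matrix of the rows of `1 + j Φ`. -/
noncomputable def thetaTildeDet {m n : ℕ} (φ : Fin m × Fin n → ℝ) : ℂ :=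
  (thetaTilde (Matrix.of (Function.curry φ)) *
    (thetaTilde (Matrix.of (Function.curry φ)))ᴴ).det

theorem measurable_thetaTildeDet {m n : ℕ} :
    Measurable (thetaTildeDet : (Fin m × Fin n → ℝ) → ℂ) := by
  have h : Continuous fun φ : Fin m × Fin n → ℝ => thetaTilde (Matrix.of (Function.curry φ)) := by
    refine continuous_matrix fun i j => ?_
    simp only [thetaTilde, Matrix.of_apply, Function.curry]
    fun_prop
  exact (Continuous.matrix_det (h.matrix_mul h.matrix_conjTranspose)).measurable

theorem map_thetaTildeDet_eq_map_shiftedRowsDet (k n : ℕ) (v : ℝ≥0) :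
    (gaussianPi (Fin (k + 1) × Fin n) v).map thetaTildeDet =
      (gaussianPi (Fin (k + 1) × Fin n) v).map (shiftedRowsDet fun _ => √(k + 1)) := by
  obtain ⟨Q, hQ, hdet⟩ := exists_orthogonal_det_thetaTilde k n
  have mQ : Measurable (rotateColumns Q : (Fin (k + 1) × Fin n → ℝ) →ₗ[ℝ] _) :=
    (LinearMap.continuous_of_finiteDimensional _).measurable
  conv_rhs => rw [← map_rotateColumns_gaussianPi hQ v]
  rw [Measure.map_map (measurable_shiftedRowsDet _) mQ]
  exact congrArg (fun g => Measure.map g _) (funext hdet)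

theorem lintegral_shiftedRowsDet {k n : ℕ} (v : ℝ≥0) (a : Fin n → ℝ) {f : ℂ → ENNReal}
    (hf : Measurable f) :
    ∫⁻ φ, f (shiftedRowsDet a φ) ∂(gaussianPi (Fin (k + 1) × Fin n) v) =
      ∫⁻ G, ∫⁻ b, f (shiftedDet G b a) ∂(gaussianPi _ v) ∂(gaussianPi (Fin k × Fin n) v) :=
  lintegral_gaussianPi_succ v (f := fun G b => f (shiftedDet G b a))
    (hf.comp (measurable_shiftedDet (by fun_prop) (by fun_prop) (by fun_prop)))

theorem map_thetaTildeDet_gaussianPi {k d : ℕ} (hd : 0 < d) (v : ℝ≥0) :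
    (gaussianPi (Fin (k + 1) × Fin (k + d)) v).map thetaTildeDet =
      ((chiSqLaw d v).prod ((betaLaw ((d : ℝ) / 2) ((k : ℝ) / 2)).prod
        (Measure.pi fun i : Fin k => chiSqLaw (k + d - i) v))).map
        (fun z => (((z.1 + (((k + d : ℕ) : ℝ) * ((k + 1 : ℕ) : ℝ)) * z.2.1) *
          ∏ i, z.2.2 i : ℝ) : ℂ)) := by
  have := isProbabilityMeasure_betaLaw_half (k := k) hd
  have mg : Measurable (gramDet : (Fin k × Fin (k + d) → ℝ) → ℝ) := measurable_gramDet
  rw [map_thetaTildeDet_eq_map_shiftedRowsDet]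
  refine Measure.ext_of_lintegral _ fun f hf => ?_
  have hsum : ∑ _i : Fin (k + d), √((k : ℝ) + 1) ^ 2 = ((k + d : ℕ) : ℝ) * ((k + 1 : ℕ) : ℝ) := by
    rw [Real.sq_sqrt (by positivity)]
    simp [mul_add]
  rw [lintegral_map hf (measurable_shiftedRowsDet _), lintegral_map hf (by fun_prop),
    lintegral_shiftedRowsDet v _ hf, lintegral_shiftedDet hd v hf, hsum]
  set c : ℝ := ((k + d : ℕ) : ℝ) * ((k + 1 : ℕ) : ℝ)
  set β := betaLaw ((d : ℝ) / 2) ((k : ℝ) / 2)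
  have m2 : Measurable fun t : ℝ => ∫⁻ x, ∫⁻ y,
      f ((t * (x + c * y) : ℝ) : ℂ) ∂β ∂(chiSqLaw d v) := by
    have m3 : Measurable fun z : (ℝ × ℝ) × ℝ => f ((z.1.1 * (z.1.2 + c * z.2) : ℝ) : ℂ) :=
      hf.comp (by fun_prop)
    exact m3.lintegral_prod_right'.lintegral_prod_right'
  rw [← lintegral_map m2 mg, map_gramDet_gaussianPi (k + d) v (Nat.le_add_right k d),
    lintegral_map m2 (by fun_prop)]
  have m5 : Measurable fun z : ℝ × ℝ × (Fin k → ℝ) =>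
      f (((z.1 + c * z.2.1) * ∏ i, z.2.2 i : ℝ) : ℂ) := hf.comp (by fun_prop)
  rw [lintegral_prod _ m5.aemeasurable]
  have m4 : Measurable fun z : ((Fin k → ℝ) × ℝ) × ℝ =>
      f (((∏ i, z.1.1 i) * (z.1.2 + c * z.2) : ℝ) : ℂ) := hf.comp (by fun_prop)
  rw [lintegral_lintegral_swap m4.lintegral_prod_right'.aemeasurable]
  refine lintegral_congr fun x => ?_
  have m7 : Measurable fun z : ℝ × (Fin k → ℝ) =>
      f (((x + c * z.1) * ∏ i, z.2 i : ℝ) : ℂ) := hf.comp (by fun_prop)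
  rw [lintegral_prod _ m7.aemeasurable]
  have m6 : Measurable fun z : (Fin k → ℝ) × ℝ =>
      f (((∏ i, z.1 i) * (x + c * z.2) : ℝ) : ℂ) := hf.comp (by fun_prop)
  rw [lintegral_lintegral_swap m6.aemeasurable]
  refine lintegral_congr fun y => lintegral_congr fun z => ?_
  rw [mul_comm]

/-! ### Transfer to the random matrix and the two cases -/

theorem identDistrib_det_thetaTilde {Ω : Type*} [MeasurableSpace Ω] (P : Measure Ω)
    [IsProbabilityMeasure P] {m n : ℕ} (hm : 1 ≤ m) (hmn : m ≤ n) (v : ℝ≥0)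
    (Φ : Ω → Matrix (Fin m) (Fin n) ℝ)
    (hindep : iIndepFun (fun (p : Fin m × Fin n) (ω : Ω) => Φ ω p.1 p.2) P)
    (hlaw : ∀ k l, HasLaw (fun ω => Φ ω k l) (gaussianReal 0 v) P) :
    IdentDistrib
      (fun ω => (thetaTilde (Φ ω) * (thetaTilde (Φ ω))ᴴ).det)
      (fun z : ℝ × ℝ × (Fin (m - 1) → ℝ) =>
        (((z.1 + (n : ℝ) * (m : ℝ) * z.2.1) * ∏ i, z.2.2 i : ℝ) : ℂ))
      P
      ((chiSqLaw (absDiff n m + 1) v).prod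
        ((betaLaw (((absDiff n m : ℝ) + 1) / 2) (((m : ℝ) - 1) / 2)).prod
          (Measure.pi fun i : Fin (m - 1) => chiSqLaw (n - (i.val + 1) + 1) v))) := by
  obtain ⟨k, rfl⟩ := Nat.exists_eq_add_of_le' hm
  obtain ⟨e, rfl⟩ := Nat.exists_eq_add_of_le hmn
  have hX : AEMeasurable (fun ω (p : Fin (k + 1) × Fin (k + 1 + e)) => Φ ω p.1 p.2) P :=
    aemeasurable_pi_lambda _ fun p => (hlaw p.1 p.2).aemeasurable
  have hmap : P.map (fun ω (p : Fin (k + 1) × Fin (k + 1 + e)) => Φ ω p.1 p.2) =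
      gaussianPi _ v := by
    refine (hindep.map_fun_eq_pi_map fun p : Fin (k + 1) × Fin (k + 1 + e) =>
      (hlaw p.1 p.2).aemeasurable).trans ?_
    simp_rw [fun p : Fin (k + 1) × Fin (k + 1 + e) => (hlaw p.1 p.2).map_eq]
    rfl
  have hcomp : (fun ω => (thetaTilde (Φ ω) * (thetaTilde (Φ ω))ᴴ).det) =
      thetaTildeDet ∘ fun ω (p : Fin (k + 1) × Fin (k + 1 + e)) => Φ ω p.1 p.2 := rfl
  rw [hcomp]
  refine ⟨measurable_thetaTildeDet.comp_aemeasurable hX, by fun_prop, ?_⟩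
  have hd : absDiff (k + 1 + e) (k + 1) = e := by
    unfold absDiff
    omega
  -- With `e = M_d`, the number of free directions is `d = e + 1`: only `k` of the `k + 1` rows lie
  -- in `G`.
  have hkd : k + 1 + e = k + (e + 1) := by omega
  rw [← AEMeasurable.map_map_of_aemeasurable measurable_thetaTildeDet.aemeasurable hX, hmap, hd]
  have h2 := map_thetaTildeDet_gaussianPi (k := k) (d := e + 1) (Nat.succ_pos e) v
  rw [← hkd] at h2
  rw [h2]
  congr 2
  · congr 2
    · push_cast; ring
    · push_cast; ring
    · ext1 i
      congr 1
      have := i.isLt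
      omega

theorem thetaTilde_transpose {m n : ℕ} (Φ : Matrix (Fin m) (Fin n) ℝ) :
    thetaTilde Φᵀ = (thetaTilde Φ)ᵀ := rfl

/-- Transposing inside the determinant exchanges the roles of rows and columns, which reduces the
tall case to the wide one. -/
theorem det_conjTranspose_mul_thetaTilde {m n : ℕ} (Φ : Matrix (Fin m) (Fin n) ℝ) :
    ((thetaTilde Φ)ᴴ * thetaTilde Φ).det = (thetaTilde Φᵀ * (thetaTilde Φᵀ)ᴴ).det := by
  rw [← Matrix.det_transpose, Matrix.transpose_mul, thetaTilde_transpose]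
  rfl

theorem absDiff_comm (a b : ℕ) : absDiff a b = absDiff b a := by
  unfold absDiff
  omega

theorem mainTheorem4 {Ω : Type*} [MeasurableSpace Ω] (P : Measure Ω) [IsProbabilityMeasure P]
    (M_T M_R : ℕ) (hT : 1 ≤ M_T) (hR : 1 ≤ M_R) (σ : ℝ≥0)
    (Φ : Ω → Matrix (Fin M_R) (Fin M_T) ℝ)
    (hΦ_indep : iIndepFun (fun (p : Fin M_R × Fin M_T) (ω : Ω) => Φ ω p.1 p.2) P)
    (hΦ_law : ∀ (k : Fin M_R) (l : Fin M_T),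
      HasLaw (fun ω => Φ ω k l) (gaussianReal 0 (σ ^ 2)) P) :
    (M_R ≤ M_T →
      IdentDistrib
        (fun ω => (thetaTilde (Φ ω) * (thetaTilde (Φ ω))ᴴ).det)
        (fun z : ℝ × ℝ × (Fin (M_R - 1) → ℝ) =>
          (((z.1 + (M_T : ℝ) * (M_R : ℝ) * z.2.1) * ∏ i, z.2.2 i : ℝ) : ℂ))
        P
        ((chiSqLaw (absDiff M_T M_R + 1) (σ ^ 2)).prod
          ((betaLaw (((absDiff M_T M_R : ℝ) + 1) / 2) (((M_R : ℝ) - 1) / 2)).prod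
            (Measure.pi fun i : Fin (M_R - 1) =>
              chiSqLaw (M_T - (i.val + 1) + 1) (σ ^ 2))))) ∧
    (M_T < M_R →
      IdentDistrib
        (fun ω => ((thetaTilde (Φ ω))ᴴ * thetaTilde (Φ ω)).det)
        (fun z : ℝ × ℝ × (Fin (M_T - 1) → ℝ) =>
          (((z.1 + (M_T : ℝ) * (M_R : ℝ) * z.2.1) * ∏ i, z.2.2 i : ℝ) : ℂ))
        P
        ((chiSqLaw (absDiff M_T M_R + 1) (σ ^ 2)).prod
          ((betaLaw (((absDiff M_T M_R : ℝ) + 1) / 2) (((M_T : ℝ) - 1) / 2)).prod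
            (Measure.pi fun i : Fin (M_T - 1) =>
              chiSqLaw (M_R - (i.val + 1) + 1) (σ ^ 2))))) := by

  refine ⟨fun h => identDistrib_det_thetaTilde P hR h _ Φ hΦ_indep hΦ_law, fun h => ?_⟩
  have hindep : iIndepFun (fun (p : Fin M_T × Fin M_R) (ω : Ω) => (Φ ω)ᵀ p.1 p.2) P :=
    hΦ_indep.precomp (g := Prod.swap) Prod.swap_injective
  have := identDistrib_det_thetaTilde P hT h.le (σ ^ 2) (fun ω => (Φ ω)ᵀ) hindep
    fun k l => hΦ_law l k
  simp_rw [det_conjTranspose_mul_thetaTilde]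
  rw [absDiff_comm M_T M_R, mul_comm (M_T : ℝ)]
  exact this
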